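/- **Setting.** Let $\mathcal G=(\mathcal V,\mathcal E)$ be a finite directed graph without self-loops, with a source $s$ and a target $d$ such that $d$ is reachable from $s$. A path is a vertex sequence from $s$ to $d$ whose consecutive vertices are joined by edges; the set $\mathcal I$ of super-arms consists of the edge sets $\boldsymbol a\subseteq\mathcal E$ of such paths. Each edge $e$ has an unknown mean reward $\theta^*_e\sim\mathcal N(\mu_e,\varsigma_e^2)$ ($\varsigma_e>0$), independently over edges. Given $\boldsymbol\theta^*$, the reward of edge $e$ in round $t$ is $r_t(e)\sim\mathcal N(\theta^*_e,\sigma_e^2)$, independently over edges and rounds, with known $0<\sigma_e^2\le 1$. Let $c_e(\boldsymbol\theta)$ be the expected cost of edge $e$ when the mean rewards are $\boldsymbol\theta$, in one of two models: (i) rectified Gaussian, $c_e(\boldsymbol\theta)=\mathbb E[\max(0,X)]$ with $X\sim\mathcal N(-\theta_e,\sigma_e^2)$; (ii) Gaussian, $c_e(\boldsymbol\theta)=-\theta_e$. The expected reward of a super-arm is $f_{\boldsymbol\theta}(\boldsymbol a)=-\sum_{e\in\boldsymbol a}c_e(\boldsymbol\theta)$. **Algorithm (single-agent Thompson Sampling).**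 Every edge is observed once initially, and the Gaussian prior of $\theta^*_e$ is updated with that observation, giving $\mathcal N(\mu_{e,0},\varsigma_{e,0}^2)$. In round $t=1,2,\dots$: sample independently $\tilde\theta_e\sim\mathcal N(\mu_{e,t-1},\varsigma_{e,t-1}^2)$ for all $e$; select a shortest path $\boldsymbol a_t\in\arg\min_{\boldsymbol a\in\mathcal I}\sum_{e\in\boldsymbol a}c_e(\tilde{\boldsymbol\theta})$ by any fixed (measurable) shortest-path solver; observe $r_t(e)$ for $e\in\boldsymbol a_t$; and for each $e\in\boldsymbol a_t$ set $$\varsigma_{e,t}^2=\Big(\tfrac1{\varsigma_{e,t-1}^2}+\tfrac1{\sigma_e^2}\Big)^{-1},\qquad \mu_{e,t}=\varsigma_{e,t}^2\Big(\tfrac{\mu_{e,t-1}}{\varsigma_{e,t-1}^2}+\tfrac{r_t(e)}{\sigma_e^2}\Big),$$ leaving the parameters of the other edges unchanged. **Claim.** With $$\mathrm{Regret}(T)=\sum_{t=1}^T\Big(\max_{\boldsymbol a\in\mathcal I}f_{\boldsymbol\theta^*}(\boldsymbol a)-f_{\boldsymbol\theta^*}(\boldsymbol a_t)\Big),\qquad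 \mathrm{BayesRegret}(T)=\mathbb E[\mathrm{Regret}(T)],$$ in both models $\mathrm{Regret}(T)$ is integrable and $\mathrm{BayesRegret}(T)\le\tilde{\mathcal O}(|\mathcal E|\sqrt T)$. That is, there are absolute constants $C\in\mathbb R$ and $k\in\mathbb N$, independent of the graph, of all parameters $\mu_e,\varsigma_e,\sigma_e$, of the solver and of $T$, such that for every $T\ge 1$ $$\mathrm{BayesRegret}(T)\le C\,|\mathcal E|\sqrt T\,(1+\log T)^k .$$ -/

import Mathlib

open MeasureTheory ProbabilityTheory
open scoped NNReal

/-- A finite directed road network: every edge is an ordered pair of distinct vertices. -/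
structure RoadNetwork (V : Type*) where
  edges : Finset (V × V)
  ne_of_mem : ∀ e ∈ edges, e.1 ≠ e.2

namespace RoadNetwork

variable {V : Type*} (G : RoadNetwork V)

/-- The type of edges; `Fintype.card G.Edge = G.edges.card`. -/
abbrev Edge : Type _ := {e : V × V // e ∈ G.edges}

/-- The vertex sequence `l` is a directed path from `s` to `d`. -/
def IsPath (s d : V) (l : List V) : Prop :=
  l.head? = some s ∧ l.getLast? = some d ∧ l.IsChain (fun x y => (x, y) ∈ G.edges)

variable [DecidableEq V]

/-- The set of edges joining consecutive vertices of the sequence `l`. -/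
def edgesOf (l : List V) : Finset G.Edge :=
  Finset.univ.filter (fun e => e.1 ∈ l.zip l.tail)

open Classical in
/-- The feasible super-arms: the edge sets of the directed paths from `s` to `d`. -/
noncomputable def superArms (s d : V) : Finset (Finset G.Edge) :=
  Finset.univ.filter (fun a => ∃ l : List V, G.IsPath s d l ∧ G.edgesOf l = a)

/-- `solve` is a (measurable) shortest-path solver from `s` to `d` for the edge weight vectors
in `W`: for `w ∈ W` it returns a path of minimal total weight. -/
structure IsShortestPathSolver (s d : V) (W : Set (G.Edge → ℝ))
    (solve : (G.Edge → ℝ) → Finset G.Edge) : Prop where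
  measurableSet_eq : ∀ a : Finset G.Edge, MeasurableSet {w | solve w = a}
  mem : ∀ w ∈ W, solve w ∈ G.superArms s d
  le : ∀ w ∈ W, ∀ a ∈ G.superArms s d, ∑ e ∈ solve w, w e ≤ ∑ e ∈ a, w e

end RoadNetwork

namespace EnergyBandit

/-- Known parameters of the Bayesian edge model: the mean reward of edge `e` has the prior
`N(priorMean e, priorSd e ^ 2)`, and a reward of `e` given its mean `x` is
`N(x, noiseSd e ^ 2)`. -/
structure Model (E : Type*) where
  priorMean : E → ℝ
  priorSd : E → ℝ≥0
  noiseSd : E → ℝ≥0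

/-- Parameters of a product Gaussian belief: means and variances. -/
structure Belief (E : Type*) where
  mean : E → ℝ
  var : E → ℝ≥0

/-- Law of `max 0 X` for `X ~ N(m, v)`. -/
noncomputable def rectifiedGaussian (m : ℝ) (v : ℝ≥0) : Measure ℝ :=
  (gaussianReal m v).map (fun x => max 0 x)

/-- A sample point: the true mean rewards of the edges, the standardized reward noise of each
round, and the standard normal numbers used by the algorithm in each round. -/
abbrev Outcome (E : Type*) : Type _ := (E → ℝ) × (ℕ → E → ℝ) × (ℕ → E → ℝ)

section

variable {E : Type*} [Fintype E] [DecidableEq E] (M : Model E)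

/-- Expected edge costs in the rectified Gaussian model, as a function of the mean rewards
`θ`: the mean of `max 0 X` for `X ~ N(-θ e, noiseSd e ^ 2)`. -/
noncomputable def rectifiedCost (θ : E → ℝ) (e : E) : ℝ :=
  ∫ z, z ∂(rectifiedGaussian (-θ e) (M.noiseSd e ^ 2))

/-- Expected edge costs in the (non-rectified) Gaussian model: costs are negated rewards. -/
def gaussianCost (θ : E → ℝ) (e : E) : ℝ := -θ e

/-- Joint law: independent true means drawn from the prior, and independent standard normal
variables for all edges and rounds. -/
noncomputable def law : Measure (Outcome E) :=
  (Measure.pi fun e => gaussianReal (M.priorMean e) (M.priorSd e ^ 2)).prod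
    ((Measure.infinitePi fun _ : ℕ => Measure.pi fun _ : E => gaussianReal 0 1).prod
      (Measure.infinitePi fun _ : ℕ => Measure.pi fun _ : E => gaussianReal 0 1))

/-- The reward of edge `e` in round `t`, with law `N(θ e, noiseSd e ^ 2)` given the true mean
rewards `θ = ω.1`. It is observed by the agent only when `e` is traversed. -/
def reward (t : ℕ) (ω : Outcome E) (e : E) : ℝ := ω.1 e + M.noiseSd e * ω.2.1 t e

/-- The belief before any observation. -/
def priorBelief : Belief E := ⟨M.priorMean, fun e => M.priorSd e ^ 2⟩

/-- Conjugate Gaussian update of the belief `p` after traversing the edges in `a` and observing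
the rewards `r e` for `e ∈ a`. -/
noncomputable def update (a : Finset E) (r : E → ℝ) (p : Belief E) : Belief E where
  mean e := if e ∈ a then
      (1 / (p.var e : ℝ) + 1 / (M.noiseSd e : ℝ) ^ 2)⁻¹ *
        (p.mean e / p.var e + r e / (M.noiseSd e : ℝ) ^ 2)
    else p.mean e
  var e := if e ∈ a then (1 / p.var e + 1 / M.noiseSd e ^ 2)⁻¹ else p.var e

/-- The sample from the belief `p` produced from standard normal numbers `ζ`. -/
noncomputable def sample (p : Belief E) (ζ : E → ℝ) (e : E) : ℝ :=
  p.mean e + Real.sqrt (p.var e) * ζ e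

/-- The path selected by Thompson Sampling under the belief `p`: sample mean rewards, compute
the expected edge costs for them, and solve the shortest path problem. -/
noncomputable def select (cost : (E → ℝ) → E → ℝ) (solve : (E → ℝ) → Finset E)
    (p : Belief E) (ζ : E → ℝ) : Finset E :=
  solve (cost (sample p ζ))

/-- The belief after round `t` of the online algorithm. Round `0` stands for the initial plays:
every edge has been observed once. In round `t + 1` a path is selected from the belief after
round `t`, and the belief is updated with the rewards of its edges. -/
noncomputable def belief (cost : (E → ℝ) → E → ℝ) (solve : (E → ℝ) → Finset E) :
    ℕ → Outcome E → Belief E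
  | 0, ω => update M Finset.univ (reward M 0 ω) (priorBelief M)
  | t + 1, ω =>
      update M (select cost solve (belief cost solve t ω) (ω.2.2 (t + 1)))
        (reward M (t + 1) ω) (belief cost solve t ω)

/-- The path selected in round `t + 1`. -/
noncomputable def action (cost : (E → ℝ) → E → ℝ) (solve : (E → ℝ) → Finset E)
    (t : ℕ) (ω : Outcome E) : Finset E :=
  select cost solve (belief M cost solve t ω) (ω.2.2 (t + 1))

/-- Expected reward of the super-arm `a` when the mean rewards are `θ`. -/
def expectedReward (cost : (E → ℝ) → E → ℝ) (θ : E → ℝ) (a : Finset E) : ℝ :=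
  -∑ e ∈ a, cost θ e

/-- Cumulative regret of rounds `1, …, T` against the best super-arm in `arms` for the true
mean rewards. -/
noncomputable def regret (arms : Finset (Finset E)) (h : arms.Nonempty)
    (cost : (E → ℝ) → E → ℝ) (solve : (E → ℝ) → Finset E) (T : ℕ) (ω : Outcome E) : ℝ :=
  ∑ t ∈ Finset.range T,
    (arms.sup' h (expectedReward cost ω.1) -
      expectedReward cost ω.1 (action M cost solve t ω))

/-- Bayesian regret: the expected regret over problem instances drawn from the prior (and over
the rewards and the randomness of the algorithm). -/
noncomputable def bayesRegret (arms : Finset (Finset E)) (h : arms.Nonempty)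
    (cost : (E → ℝ) → E → ℝ) (solve : (E → ℝ) → Finset E) (T : ℕ) : ℝ :=
  ∫ ω, regret M arms h cost solve T ω ∂(law M)

end

end EnergyBandit

/-! Thompson Sampling is analysed by posterior sampling. Given the history, the true means and the
means sampled by the algorithm have the same law (`identDistrib_roundSample`). The optimal value is
the solver's value at the true means, so its expectation equals that of the played arm's value at
the sampled means. The expected regret of a round is therefore the expectation of a difference of
costs of one and the same arm, at the true and at the sampled means.

Both costs are 1-Lipschitz in the mean of their own edge, so this difference is at most the sum over
traversed edges of the distances of the two values from the posterior mean. By AM-GM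
(`abs_sub_mean_le`) each distance is at most Q/(2l) + l v/2, where v is the posterior variance and Q
the squared deviation divided by v. Q has expectation 1 for the true and for the sampled means,
hence each edge contributes at most 1/l + l E[v; edge traversed] (`integral_regret_round_le`). No
concentration inequality is needed.

Each observation raises the precision of an edge by at least 1, because the noise variance is at
most 1. The variances met along the plays of an edge are thus dominated by 1, 1/2, 1/3, ..., with
sum at most 1 + log T (`sum_var_le`). Taking l = √T and summing over rounds and edges gives |E| √T
(2 + log T).

The identity of laws is proved by induction on rounds: calibration of the belief survives an update
(`IsCalibrated.update`), because Gaussian conjugacy is a planar rotation of two standard normals on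
each edge (`lintegral_update_sample`). -/

namespace EnergyBandit

/-! ### Refreshing one coordinate of an i.i.d. family. -/

section Resampling

variable {ι : Type*} {X : Type*} [MeasurableSpace X]

/-- Replacing one coordinate of an i.i.d. family by a fresh independent copy preserves its law. -/
lemma measurePreserving_update_infinitePi [DecidableEq ι] (μ : Measure X) [IsProbabilityMeasure μ]
    (n : ι) :
    MeasurePreserving (fun p : (ι → X) × X => Function.update p.1 n p.2)
      ((Measure.infinitePi fun _ : ι => μ).prod μ) (Measure.infinitePi fun _ : ι => μ) := by
  have hm : Measurable fun p : (ι → X) × X => Function.update p.1 n p.2 := by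
    refine measurable_pi_iff.2 fun i => ?_
    by_cases h : i = n
    · subst h; simpa using measurable_snd
    · simp only [Function.update_of_ne h]; fun_prop
  refine ⟨hm, Measure.eq_infinitePi _ fun s t ht => ?_⟩
  rw [Measure.map_apply hm (.pi s.countable_toSet fun i _ => ht i)]
  by_cases hn : n ∈ s
  · have : (fun p : (ι → X) × X => Function.update p.1 n p.2) ⁻¹' (s : Set ι).pi t
        = ((s.erase n : Finset ι) : Set ι).pi t ×ˢ t n := by
      ext p
      simp only [Set.mem_preimage, Set.mem_pi, Finset.mem_coe, Set.mem_prod, Finset.mem_erase]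
      constructor
      · intro h
        refine ⟨fun i hi => ?_, by simpa using h n hn⟩
        simpa [Function.update_of_ne hi.1] using h i hi.2
      · rintro ⟨h1, h2⟩ i hi
        by_cases h : i = n
        · subst h; simpa using h2
        · simpa [Function.update_of_ne h] using h1 i ⟨h, hi⟩
    rw [this, Measure.prod_prod, Measure.infinitePi_pi _ fun i _ => ht i,
      Finset.prod_erase_mul _ _ hn]
  · have : (fun p : (ι → X) × X => Function.update p.1 n p.2) ⁻¹' (s : Set ι).pi t
        = (s : Set ι).pi t ×ˢ Set.univ := by
      ext p
      simp only [Set.mem_preimage, Set.mem_pi, Finset.mem_coe, Set.mem_prod, Set.mem_univ,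
        and_true]
      refine forall₂_congr fun i hi => ?_
      rw [Function.update_of_ne (by rintro rfl; exact hn hi)]
    rw [this, Measure.prod_prod, Measure.infinitePi_pi _ fun i _ => ht i]
    simp

end Resampling

/-! ### Rotation invariance of standard normal vectors. -/

section Rotation

/-- A planar rotation preserves the law of two independent standard normal variables. -/
lemma measurePreserving_rotation_gaussianReal {c s : ℝ} (h : c ^ 2 + s ^ 2 = 1) :
    MeasurePreserving (fun x : ℝ × ℝ => (c * x.1 + s * x.2, -s * x.1 + c * x.2))
      ((gaussianReal 0 1).prod (gaussianReal 0 1)) ((gaussianReal 0 1).prod (gaussianReal 0 1)) := by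
  refine ⟨by fun_prop, ?_⟩
  -- The angle is the argument of the unit complex number c + s i.
  obtain ⟨θ, hc, hs⟩ : ∃ θ : ℝ, Real.cos θ = c ∧ Real.sin θ = s := by
    have hz : ‖(⟨c, s⟩ : ℂ)‖ = 1 := by
      rw [Complex.norm_def, Complex.normSq_mk, ← pow_two, ← pow_two, h, Real.sqrt_one]
    refine ⟨Complex.arg ⟨c, s⟩, ?_, ?_⟩
    · rw [Complex.cos_arg (by intro h0; rw [h0] at hz; simp at hz), hz, div_one]
    · rw [Complex.sin_arg, hz, div_one]
  have := IsGaussian.map_rotation_eq_self (μ := gaussianReal 0 1)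
    (by simp) θ
  convert this using 2
  ext x <;> simp [ContinuousLinearMap.rotation_apply, hc, hs]

variable {E : Type*} [Fintype E]

/-- The law of a vector of independent standard normal variables. -/
noncomputable abbrev stdNormal (E : Type*) [Fintype E] : Measure (E → ℝ) :=
  Measure.pi fun _ : E => gaussianReal 0 1

/-- The angle may vary with the edge: observed edges get rotated in the conjugacy step, the others
stay fixed. -/
lemma measurePreserving_rotation_stdNormal {c s : E → ℝ} (h : ∀ e, c e ^ 2 + s e ^ 2 = 1) :
    MeasurePreserving (fun x : (E → ℝ) × (E → ℝ) =>
        ((fun e => c e * x.1 e + s e * x.2 e, fun e => -s e * x.1 e + c e * x.2 e) :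
          (E → ℝ) × (E → ℝ)))
      ((stdNormal E).prod (stdNormal E)) ((stdNormal E).prod (stdNormal E)) := by
  have h1 := measurePreserving_arrowProdEquivProdArrow ℝ ℝ E
    (fun _ => gaussianReal 0 1) (fun _ => gaussianReal 0 1)
  have h2 := measurePreserving_pi (fun _ : E => (gaussianReal 0 1).prod (gaussianReal 0 1))
    (fun _ : E => (gaussianReal 0 1).prod (gaussianReal 0 1))
    (fun e => measurePreserving_rotation_gaussianReal (h e))
  exact h1.comp (h2.comp (h1.symm _))

end Rotation

/-! ### Measurability of beliefs, samples and updates. -/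

section Measurability

variable {E : Type*}

instance : MeasurableSpace (Belief E) :=
  MeasurableSpace.comap (fun p : Belief E => (p.mean, p.var)) inferInstance

lemma measurable_belief_iff {α : Type*} [MeasurableSpace α] {f : α → Belief E} :
    Measurable f ↔ (∀ e, Measurable fun x => (f x).mean e) ∧ ∀ e, Measurable fun x => (f x).var e := by
  rw [measurable_comap_iff]
  exact ⟨fun h => ⟨measurable_pi_iff.1 h.fst, measurable_pi_iff.1 h.snd⟩,
    fun h => (measurable_pi_iff.2 h.1).prodMk (measurable_pi_iff.2 h.2)⟩

lemma measurable_mean (e : E) : Measurable fun p : Belief E => p.mean e :=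
  (measurable_belief_iff.1 measurable_id).1 e

lemma measurable_var (e : E) : Measurable fun p : Belief E => p.var e :=
  (measurable_belief_iff.1 measurable_id).2 e

lemma measurable_sample : Measurable fun q : Belief E × (E → ℝ) => sample q.1 q.2 := by
  refine measurable_pi_iff.2 fun e => ?_
  have h1 : Measurable fun q : Belief E × (E → ℝ) => q.1.mean e :=
    (measurable_mean e).comp measurable_fst
  have h2 : Measurable fun q : Belief E × (E → ℝ) => q.1.var e :=
    (measurable_var e).comp measurable_fst
  have h3 : Measurable fun q : Belief E × (E → ℝ) => (q.1.var e : ℝ) := measurable_coe_nnreal_real.comp h2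
  have h4 : Measurable fun q : Belief E × (E → ℝ) => q.2 e := by fun_prop
  exact h1.add (h3.sqrt.mul h4)

variable [DecidableEq E]

lemma measurable_update (M : Model E) {α : Type*} [MeasurableSpace α] {A : α → Finset E}
    {r : α → E → ℝ} {p : α → Belief E} (hA : ∀ e, MeasurableSet {x | e ∈ A x})
    (hr : Measurable r) (hp : Measurable p) :
    Measurable fun x => update M (A x) (r x) (p x) := by
  have h1 := fun e => (measurable_belief_iff.1 hp).1 e
  have h2 := fun e => (measurable_belief_iff.1 hp).2 e
  have h3 : ∀ e, Measurable fun x => ((p x).var e : ℝ) := fun e =>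
    measurable_coe_nnreal_real.comp (h2 e)
  have h4 : ∀ e, Measurable fun x => r x e := fun e => measurable_pi_iff.1 hr e
  refine measurable_belief_iff.2 ⟨fun e => ?_, fun e => ?_⟩
  · refine Measurable.ite (hA e) ?_ (h1 e)
    have := h1 e; have := h3 e; have := h4 e
    fun_prop
  · refine Measurable.ite (hA e) ?_ (h2 e)
    have := h2 e
    fun_prop

end Measurability

/-! ### Gaussian conjugacy as a rotation. -/

section Conjugacy

variable {E : Type*} [DecidableEq E] (M : Model E)

lemma update_var_pos {a : Finset E} {r : E → ℝ} {p : Belief E} (hp : ∀ e, 0 < p.var e)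
    (e : E) : 0 < (update M a r p).var e := by
  have := hp e
  simp only [update]
  split_ifs
  · have : 0 < 1 / p.var e := by positivity
    positivity
  · exact this

variable [Fintype E]

/-- Gaussian conjugacy: after updating the belief `p` with noisy observations of a sample from it,
that sample is distributed like a fresh sample from the updated belief. -/
lemma lintegral_update_sample (hM : ∀ e, 0 < M.noiseSd e) (a : Finset E) {p : Belief E}
    (hp : ∀ e, 0 < p.var e) {F : Belief E × (E → ℝ) → ENNReal} (hF : Measurable F) :
    ∫⁻ y, F (update M a (fun e => sample p y.2 e + M.noiseSd e * y.1 e) p, sample p y.2)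
        ∂((stdNormal E).prod (stdNormal E)) =
      ∫⁻ y, ∫⁻ w, F (update M a (fun e => sample p y.2 e + M.noiseSd e * y.1 e) p,
        sample (update M a (fun e => sample p y.2 e + M.noiseSd e * y.1 e) p) w) ∂(stdNormal E)
          ∂((stdNormal E).prod (stdNormal E)) := by
  -- `D` is the predictive standard deviation of the reward. On observed edges the rotation sends
  -- (reward noise, sample noise) to the innovation (reward minus prior mean) divided by `D`,
  -- together with an independent standard normal; elsewhere it is the identity. `q` is the updated
  -- belief as a function of the standardized innovation alone.
  let D : E → ℝ := fun e => Real.sqrt (p.var e + (M.noiseSd e : ℝ) ^ 2)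
  let c : E → ℝ := fun e => if e ∈ a then M.noiseSd e / D e else 1
  let s : E → ℝ := fun e => if e ∈ a then Real.sqrt (p.var e) / D e else 0
  let q : (E → ℝ) → Belief E := fun u =>
    ⟨fun e => if e ∈ a then p.mean e + p.var e / D e * u e else p.mean e,
      fun e => if e ∈ a then (1 / p.var e + 1 / M.noiseSd e ^ 2)⁻¹ else p.var e⟩
  have hD : ∀ e, 0 < D e := fun e => Real.sqrt_pos.2 (by have := hp e; have := hM e; positivity)
  have hD2 : ∀ e, D e ^ 2 = p.var e + (M.noiseSd e : ℝ) ^ 2 := fun e =>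
    Real.sq_sqrt (by positivity)
  have hv : ∀ e, Real.sqrt (p.var e) ^ 2 = p.var e := fun e => Real.sq_sqrt (by positivity)
  have hcs : ∀ e, c e ^ 2 + s e ^ 2 = 1 := by
    intro e
    have := (hD e).ne'
    simp only [c, s]
    split_ifs
    · rw [div_pow, div_pow, ← add_div, hv, hD2, add_comm, div_self]
      rw [← hD2]; positivity
    · simp
  have hR := measurePreserving_rotation_stdNormal hcs
  set R := fun x : (E → ℝ) × (E → ℝ) =>
        ((fun e => c e * x.1 e + s e * x.2 e, fun e => -s e * x.1 e + c e * x.2 e) :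
          (E → ℝ) × (E → ℝ)) with hRdef
  have hq : Measurable q := by
    refine measurable_belief_iff.2 ⟨fun e => ?_, fun e => ?_⟩
    · simp only [q]
      split_ifs <;> fun_prop
    · simp only [q]; fun_prop
  have hup : ∀ y : (E → ℝ) × (E → ℝ),
      update M a (fun e => sample p y.2 e + M.noiseSd e * y.1 e) p = q (R y).1 := by
    intro y
    simp only [update, q, Belief.mk.injEq, and_true]
    funext e
    split_ifs with he
    · have h1 := (hD e).ne'
      have h2 : (p.var e : ℝ) ≠ 0 := by exact_mod_cast (hp e).ne'
      have h3 : (M.noiseSd e : ℝ) ≠ 0 := by exact_mod_cast (hM e).ne'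
      have h4 : (p.var e : ℝ) + (M.noiseSd e : ℝ) ^ 2 ≠ 0 := by rw [← hD2]; positivity
      have h5 : (1 / (p.var e : ℝ) + 1 / (M.noiseSd e : ℝ) ^ 2)⁻¹
          = p.var e * M.noiseSd e ^ 2 / D e ^ 2 := by
        rw [hD2]; field_simp; ring
      rw [h5]
      simp only [hRdef, c, s, he, if_true, sample]
      field_simp
      rw [hD2]
      ring
    · rfl
  -- The old sample equals the updated mean plus the updated standard deviation times the second
  -- rotated coordinate, which is independent of the updated belief.
  have hsa : ∀ y : (E → ℝ) × (E → ℝ), sample p y.2 = sample (q (R y).1) (R y).2 := by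
    intro y
    funext e
    simp only [sample, q, hRdef, c, s]
    split_ifs with he
    · have h1 := (hD e).ne'
      have h2 : (p.var e : ℝ) ≠ 0 := by exact_mod_cast (hp e).ne'
      have h3 : (M.noiseSd e : ℝ) ≠ 0 := by exact_mod_cast (hM e).ne'
      have h4 : (p.var e : ℝ) + (M.noiseSd e : ℝ) ^ 2 ≠ 0 := by rw [← hD2]; positivity
      have h5 : Real.sqrt ((1 / p.var e + 1 / M.noiseSd e ^ 2 : ℝ≥0)⁻¹ : ℝ≥0)
          = Real.sqrt (p.var e) * M.noiseSd e / D e := by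
        rw [Real.sqrt_eq_iff_mul_self_eq_of_pos]
        · rw [← pow_two, div_pow, mul_pow, hv, hD2]
          push_cast
          field_simp
          ring
        · have : 0 < Real.sqrt (p.var e) := Real.sqrt_pos.2 (by exact_mod_cast hp e)
          have := hD e
          have : (0:ℝ) < M.noiseSd e := by exact_mod_cast hM e
          positivity
      rw [h5]
      field_simp
      rw [hD2]
      have := hv e
      linear_combination (y.1 e * M.noiseSd e) * this
    · simp
  have hG : Measurable fun y : (E → ℝ) × (E → ℝ) => F (q y.1, sample (q y.1) y.2) := by
    have hq1 : Measurable fun y : (E → ℝ) × (E → ℝ) => q y.1 := hq.comp measurable_fst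
    exact hF.comp (hq1.prodMk (measurable_sample.comp (hq1.prodMk measurable_snd)))
  have hH : Measurable fun u : E → ℝ => ∫⁻ w, F (q u, sample (q u) w) ∂(stdNormal E) :=
    hG.lintegral_prod_right'
  simp_rw [hup]
  simp_rw [hsa]
  rw [hR.lintegral_comp (f := fun y => F (q y.1, sample (q y.1) y.2)) hG,
    hR.lintegral_comp (f := fun y => ∫⁻ w, F (q y.1, sample (q y.1) w) ∂(stdNormal E))
      (hH.comp measurable_fst), lintegral_prod _ hG.aemeasurable,
    lintegral_prod (fun y => ∫⁻ w, F (q y.1, sample (q y.1) w) ∂(stdNormal E))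
      (hH.comp measurable_fst).aemeasurable]
  simp

end Conjugacy
-- Refreshing the randomness of one round.
section Resampling

/-- Fubini: independent components can be refreshed separately, and the two fresh inputs then
collected in one inner integral. It serves to refresh reward noise and sampling noise together. -/
lemma lintegral_prod_resample {α β σ τ : Type*} [MeasurableSpace α] [MeasurableSpace β]
    [MeasurableSpace σ] [MeasurableSpace τ] {A : Measure α} {B : Measure β} {S : Measure σ}
    {T : Measure τ} [SFinite A] [SFinite B] [SFinite S] [SFinite T] {f : α × σ → α}
    {g : β × τ → β} (hf : MeasurePreserving f (A.prod S) A)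
    (hg : MeasurePreserving g (B.prod T) B) {H : α × β → ENNReal} (hH : Measurable H) :
    ∫⁻ p, H p ∂(A.prod B) =
      ∫⁻ p, ∫⁻ y, H (f (p.1, y.1), g (p.2, y.2)) ∂(S.prod T) ∂(A.prod B) := by
  have mf := hf.measurable
  have mg := hg.measurable
  have h1 : ∫⁻ p, H p ∂(A.prod B)
      = ∫⁻ q, ∫⁻ r, H (f q, g r) ∂(B.prod T) ∂(A.prod S) := by
    rw [lintegral_prod _ hH.aemeasurable, ← hf.lintegral_comp hH.lintegral_prod_right']
    refine lintegral_congr fun q => ?_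
    exact (hg.lintegral_comp (f := fun b => H (f q, b)) (by fun_prop)).symm
  have m1 : Measurable fun q : α × σ => ∫⁻ r, H (f q, g r) ∂(B.prod T) :=
    Measurable.lintegral_prod_right' (f := fun x : (α × σ) × (β × τ) => H (f x.1, g x.2))
      (by fun_prop)
  have m2 : Measurable fun p : α × β => ∫⁻ y, H (f (p.1, y.1), g (p.2, y.2)) ∂(S.prod T) :=
    Measurable.lintegral_prod_right'
      (f := fun x : (α × β) × (σ × τ) => H (f (x.1.1, x.2.1), g (x.1.2, x.2.2))) (by fun_prop)
  rw [h1, lintegral_prod _ m1.aemeasurable, lintegral_prod _ m2.aemeasurable]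
  refine lintegral_congr fun a => ?_
  calc ∫⁻ s, ∫⁻ r, H (f (a, s), g r) ∂(B.prod T) ∂S
      = ∫⁻ s, ∫⁻ b, ∫⁻ t, H (f (a, s), g (b, t)) ∂T ∂B ∂S := by
        refine lintegral_congr fun s => lintegral_prod _ (Measurable.aemeasurable (by fun_prop))
    _ = ∫⁻ b, ∫⁻ s, ∫⁻ t, H (f (a, s), g (b, t)) ∂T ∂S ∂B := by
        refine lintegral_lintegral_swap (Measurable.aemeasurable ?_)
        exact Measurable.lintegral_prod_right'
          (f := fun x : (σ × β) × τ => H (f (a, x.1.1), g (x.1.2, x.2))) (by fun_prop)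
    _ = _ := by
        refine lintegral_congr fun b => ?_
        exact (lintegral_prod (fun y : σ × τ => H (f (a, y.1), g (b, y.2)))
          (Measurable.aemeasurable (by fun_prop))).symm

variable {E : Type*}

/-- Replace the random numbers of round `n`. -/
def resample (n : ℕ) (ω : Outcome E) (y : (E → ℝ) × (E → ℝ)) : Outcome E :=
  (ω.1, Function.update ω.2.1 n y.1, Function.update ω.2.2 n y.2)

lemma reward_resample (M : Model E) {k n : ℕ} (h : k ≠ n) (ω : Outcome E)
    (y : (E → ℝ) × (E → ℝ)) : reward M k (resample n ω y) = reward M k ω := by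
  funext e; simp [reward, resample, Function.update_of_ne h]

lemma measurable_reward (M : Model E) (n : ℕ) :
    Measurable fun ω : Outcome E => reward M n ω := by
  unfold reward; fun_prop

variable [Fintype E] (M : Model E)

instance : IsProbabilityMeasure (law M) := by unfold law; infer_instance

lemma lintegral_law_resample (n : ℕ) {H : Outcome E → ENNReal} (hH : Measurable H) :
    ∫⁻ ω, H ω ∂(law M) =
      ∫⁻ ω, ∫⁻ y, H (resample n ω y) ∂((stdNormal E).prod (stdNormal E)) ∂(law M) := by
  have hU := measurePreserving_update_infinitePi (stdNormal E) n
  have m : Measurable fun ω : Outcome E =>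
      ∫⁻ y, H (resample n ω y) ∂((stdNormal E).prod (stdNormal E)) := by
    refine Measurable.lintegral_prod_right'
      (f := fun x : Outcome E × ((E → ℝ) × (E → ℝ)) => H (resample n x.1 x.2)) (hH.comp ?_)
    have h1 : Measurable fun x : Outcome E × ((E → ℝ) × (E → ℝ)) =>
        Function.update x.1.2.1 n x.2.1 :=
      hU.measurable.comp (f := fun x : Outcome E × ((E → ℝ) × (E → ℝ)) => (x.1.2.1, x.2.1))
        (by fun_prop)
    have h2 : Measurable fun x : Outcome E × ((E → ℝ) × (E → ℝ)) =>
        Function.update x.1.2.2 n x.2.2 :=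
      hU.measurable.comp (f := fun x : Outcome E × ((E → ℝ) × (E → ℝ)) => (x.1.2.2, x.2.2))
        (by fun_prop)
    exact (measurable_fst.comp measurable_fst).prodMk (h1.prodMk h2)
  rw [law, lintegral_prod _ hH.aemeasurable, lintegral_prod _ m.aemeasurable]
  refine lintegral_congr fun θ => ?_
  exact lintegral_prod_resample hU hU (H := fun q => H (θ, q)) (by fun_prop)

end Resampling

/-! ### Calibration of the belief and posterior sampling. -/

section PosteriorSampling

variable {E : Type*} [Fintype E] (M : Model E)

/-- The random product Gaussian belief `p` is calibrated: jointly with `p`, the true means are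
distributed like a fresh sample from `p`. -/
def IsCalibrated (p : Outcome E → Belief E) : Prop :=
  ∀ F : Belief E × (E → ℝ) → ENNReal, Measurable F →
    ∫⁻ ω, F (p ω, ω.1) ∂(law M) = ∫⁻ ω, ∫⁻ w, F (p ω, sample (p ω) w) ∂(stdNormal E) ∂(law M)

lemma isCalibrated_prior : IsCalibrated M fun _ => priorBelief M := by
  intro F hF
  have h : MeasurePreserving (sample (priorBelief M)) (stdNormal E)
      (Measure.pi fun e => gaussianReal (M.priorMean e) (M.priorSd e ^ 2)) := by
    refine measurePreserving_pi _ _ (f := fun e z => M.priorMean e + Real.sqrt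
      ((M.priorSd e ^ 2 : ℝ≥0) : ℝ) * z) fun e => ⟨by fun_prop, ?_⟩
    have := gaussianReal_map_const_mul (μ := 0) (v := 1) (M.priorSd e : ℝ)
    have h2 := gaussianReal_map_const_add (μ := 0) (v := M.priorSd e ^ 2) (M.priorMean e)
    have h3 : NNReal.mk ((M.priorSd e : ℝ) ^ 2) (sq_nonneg _) = M.priorSd e ^ 2 := rfl
    rw [mul_zero, mul_one, h3] at this
    simp only [NNReal.coe_pow, Real.sqrt_sq (NNReal.coe_nonneg _)]
    rw [zero_add, ← this, Measure.map_map (by fun_prop) (by fun_prop)] at h2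
    exact h2
  have hm : Measurable fun θ : E → ℝ => F (priorBelief M, θ) := by fun_prop
  rw [lintegral_const, measure_univ, mul_one, h.lintegral_comp hm, law,
    lintegral_prod (fun ω => F (priorBelief M, ω.1)) (Measurable.aemeasurable (by fun_prop))]
  simp

variable [DecidableEq E] {M}

/-- Since `p` ignores the noise of round `n`, that noise may be taken fresh and the true means
replaced by a sample from `p`. Once the sampling noise, hence the observed set, is fixed, the claim
is conjugacy for a deterministic belief and set. -/
lemma IsCalibrated.update (hM : ∀ e, 0 < M.noiseSd e) {p : Outcome E → Belief E}
    (hc : IsCalibrated M p) (hm : Measurable p) (n : ℕ) (hn : ∀ ω y, p (resample n ω y) = p ω)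
    (hv : ∀ ω e, 0 < (p ω).var e) {A : Belief E → (E → ℝ) → Finset E}
    (hA : ∀ e, MeasurableSet {q : Belief E × (E → ℝ) | e ∈ A q.1 q.2}) :
    IsCalibrated M fun ω => update M (A (p ω) (ω.2.2 n)) (reward M n ω) (p ω) := by
  let U : Belief E → (E → ℝ) → (E → ℝ) → (E → ℝ) → Belief E := fun b θ ξ ζ =>
    EnergyBandit.update M (A b ζ) (fun e => θ e + M.noiseSd e * ξ e) b
  have mU : ∀ {α : Type _} [MeasurableSpace α] {b : α → Belief E} {θ ξ ζ : α → E → ℝ},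
      Measurable b → Measurable θ → Measurable ξ → Measurable ζ →
      Measurable fun x => U (b x) (θ x) (ξ x) (ζ x) := by
    intro α _ b θ ξ ζ hb hθ hξ hζ
    refine measurable_update M (fun e => (hb.prodMk hζ) (hA e)) ?_ hb
    fun_prop
  have mS : ∀ {α : Type _} [MeasurableSpace α] {b : α → Belief E} {z : α → E → ℝ},
      Measurable b → Measurable z → Measurable fun x => sample (b x) (z x) :=
    fun hb hz => measurable_sample.comp (hb.prodMk hz)
  have key : ∀ F : Belief E × (E → ℝ) → ENNReal, Measurable F →
      ∫⁻ ω, F (U (p ω) ω.1 (ω.2.1 n) (ω.2.2 n), ω.1) ∂(law M) =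
        ∫⁻ ω, ∫⁻ ζ, ∫⁻ y, F (U (p ω) (sample (p ω) y.2) y.1 ζ, sample (p ω) y.2)
          ∂((stdNormal E).prod (stdNormal E)) ∂(stdNormal E) ∂(law M) := by
    intro F hF
    rw [lintegral_law_resample M n]
    swap
    · exact hF.comp ((mU hm measurable_fst (by fun_prop) (by fun_prop)).prodMk measurable_fst)
    have e1 : ∀ (ω : Outcome E) (y : (E → ℝ) × (E → ℝ)),
        F (U (p (resample n ω y)) (resample n ω y).1 ((resample n ω y).2.1 n)
          ((resample n ω y).2.2 n), (resample n ω y).1) = F (U (p ω) ω.1 y.1 y.2, ω.1) := by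
      intro ω y; rw [hn]; simp [resample]
    simp_rw [e1]
    -- Calibration of `p` is applied after integrating out the fresh noise, so that the test
    -- function depends on the belief and the means only.
    rw [hc (fun q => ∫⁻ y, F (U q.1 q.2 y.1 y.2, q.2) ∂((stdNormal E).prod (stdNormal E)))]
    swap
    · refine Measurable.lintegral_prod_right' (f := fun x : (Belief E × (E → ℝ)) ×
        ((E → ℝ) × (E → ℝ)) => F (U x.1.1 x.1.2 x.2.1 x.2.2, x.1.2)) (hF.comp ?_)
      exact (mU (by fun_prop) (by fun_prop) (by fun_prop) (by fun_prop)).prodMk (by fun_prop)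
    refine lintegral_congr fun ω => ?_
    calc ∫⁻ z, ∫⁻ y, F (U (p ω) (sample (p ω) z) y.1 y.2, sample (p ω) z)
            ∂((stdNormal E).prod (stdNormal E)) ∂(stdNormal E)
        = ∫⁻ z, ∫⁻ ζ, ∫⁻ ξ, F (U (p ω) (sample (p ω) z) ξ ζ, sample (p ω) z)
            ∂(stdNormal E) ∂(stdNormal E) ∂(stdNormal E) := by
          refine lintegral_congr fun z => lintegral_prod_symm _ (Measurable.aemeasurable ?_)
          exact hF.comp ((mU (by fun_prop) (by fun_prop) (by fun_prop) (by fun_prop)).prodMk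
            (by fun_prop))
      _ = ∫⁻ ζ, ∫⁻ z, ∫⁻ ξ, F (U (p ω) (sample (p ω) z) ξ ζ, sample (p ω) z)
            ∂(stdNormal E) ∂(stdNormal E) ∂(stdNormal E) := by
          refine lintegral_lintegral_swap (Measurable.aemeasurable ?_)
          refine Measurable.lintegral_prod_right' (f := fun x : ((E → ℝ) × (E → ℝ)) × (E → ℝ) =>
            F (U (p ω) (sample (p ω) x.1.1) x.2 x.1.2, sample (p ω) x.1.1)) (hF.comp ?_)
          have hs : Measurable fun x : ((E → ℝ) × (E → ℝ)) × (E → ℝ) => sample (p ω) x.1.1 :=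
            mS (by fun_prop) (by fun_prop)
          exact (mU (by fun_prop) hs (by fun_prop) (by fun_prop)).prodMk hs
      _ = _ := by
          refine lintegral_congr fun ζ => Eq.symm ?_
          refine lintegral_prod_symm (fun y : (E → ℝ) × (E → ℝ) =>
            F (U (p ω) (sample (p ω) y.2) y.1 ζ, sample (p ω) y.2)) (Measurable.aemeasurable
              (hF.comp ?_))
          have hs : Measurable fun x : (E → ℝ) × (E → ℝ) => sample (p ω) x.2 :=
            mS (by fun_prop) (by fun_prop)
          exact (mU (by fun_prop) hs (by fun_prop) (by fun_prop)).prodMk hs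
  intro F hF
  have mG : Measurable fun q : Belief E × (E → ℝ) =>
      ∫⁻ w, F (q.1, sample q.1 w) ∂(stdNormal E) := by
    refine Measurable.lintegral_prod_right' (f := fun x : (Belief E × (E → ℝ)) × (E → ℝ) =>
            F (x.1.1, sample x.1.1 x.2)) (hF.comp ?_)
    exact Measurable.prodMk (by fun_prop) (mS (by fun_prop) (by fun_prop))
  -- `key` serves both sides: for `F`, and for the average of `F` over a fresh sample from the
  -- updated belief, which ignores the true means.
  refine (key F hF).trans (Eq.trans ?_ (key _ mG).symm)
  refine lintegral_congr fun ω => lintegral_congr fun ζ => ?_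
  exact lintegral_update_sample M hM (A (p ω) ζ) (hv ω) hF

variable (M)

variable {cost : (E → ℝ) → E → ℝ} {solve : (E → ℝ) → Finset E}

/-- The belief after round `t` uses the noise of rounds up to `t` only. -/
lemma belief_resample {t n : ℕ} (h : t < n) (ω : Outcome E) (y : (E → ℝ) × (E → ℝ)) :
    belief M cost solve t (resample n ω y) = belief M cost solve t ω := by
  induction t with
  | zero => rw [belief, belief, reward_resample M h.ne]
  | succ t ih =>
    have ih := ih (by omega)
    have hz : (resample n ω y).2.2 (t + 1) = ω.2.2 (t + 1) := by
      simp [resample, Function.update_of_ne h.ne]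
    rw [belief, belief, ih, reward_resample M h.ne, hz]

lemma belief_var_pos (hP : ∀ e, 0 < M.priorSd e) (t : ℕ) (ω : Outcome E) (e : E) :
    0 < (belief M cost solve t ω).var e := by
  induction t generalizing e with
  | zero => exact update_var_pos M (fun e => pow_pos (hP e) 2) e
  | succ t ih => exact update_var_pos M ih e

lemma measurableSet_mem_solve (hS : ∀ a, MeasurableSet {w | solve w = a}) (e : E) :
    MeasurableSet {w | e ∈ solve w} := by
  have : {w | e ∈ solve w} = ⋃ a ∈ {a : Finset E | e ∈ a}, {w | solve w = a} := by
    ext w; simp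
  rw [this]
  exact MeasurableSet.biUnion (Set.to_countable _) fun a _ => hS a

lemma measurableSet_mem_select (hC : Measurable cost) (hS : ∀ a, MeasurableSet {w | solve w = a})
    (e : E) : MeasurableSet {q : Belief E × (E → ℝ) | e ∈ select cost solve q.1 q.2} :=
  (hC.comp measurable_sample) (measurableSet_mem_solve hS e)

lemma measurable_belief (hC : Measurable cost) (hS : ∀ a, MeasurableSet {w | solve w = a}) (t : ℕ) :
    Measurable (belief M cost solve t) := by
  induction t with
  | zero => exact measurable_update M (fun e => by simp) (measurable_reward M 0) measurable_const
  | succ t ih =>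
    refine measurable_update M (fun e => ?_) (measurable_reward M _) ih
    have : Measurable fun ω : Outcome E => (belief M cost solve t ω, ω.2.2 (t + 1)) := by fun_prop
    exact this (measurableSet_mem_select hC hS e)

lemma isCalibrated_belief (hP : ∀ e, 0 < M.priorSd e) (hM : ∀ e, 0 < M.noiseSd e)
    (hC : Measurable cost) (hS : ∀ a, MeasurableSet {w | solve w = a}) (t : ℕ) :
    IsCalibrated M (belief M cost solve t) := by
  induction t with
  | zero =>
    exact (isCalibrated_prior M).update hM measurable_const 0 (fun _ _ => rfl)
      (fun _ e => pow_pos (hP e) 2) (A := fun _ _ => Finset.univ) (fun e => by simp)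
  | succ t ih =>
    exact ih.update hM (measurable_belief M hC hS t) (t + 1)
      (belief_resample M (Nat.lt_succ_self t)) (belief_var_pos M hP t)
      (measurableSet_mem_select hC hS)

/-- The mean rewards sampled by the algorithm in round `t + 1`. -/
noncomputable def roundSample (cost : (E → ℝ) → E → ℝ) (solve : (E → ℝ) → Finset E) (t : ℕ)
    (ω : Outcome E) : E → ℝ :=
  sample (belief M cost solve t ω) (ω.2.2 (t + 1))

lemma measurable_roundSample (hC : Measurable cost)
    (hS : ∀ a, MeasurableSet {w | solve w = a}) (t : ℕ) :
    Measurable (roundSample M cost solve t) := by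
  have := measurable_belief M hC hS t
  have : Measurable fun ω : Outcome E => (belief M cost solve t ω, ω.2.2 (t + 1)) := by fun_prop
  exact measurable_sample.comp this

/-- Posterior sampling: given the history, the sampled and the true mean rewards are identically
distributed. -/
lemma identDistrib_roundSample (hP : ∀ e, 0 < M.priorSd e) (hM : ∀ e, 0 < M.noiseSd e)
    (hC : Measurable cost) (hS : ∀ a, MeasurableSet {w | solve w = a}) (t : ℕ) :
    IdentDistrib (fun ω : Outcome E => (belief M cost solve t ω, ω.1))
      (fun ω => (belief M cost solve t ω, roundSample M cost solve t ω)) (law M) (law M) := by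
  have hB := measurable_belief M hC hS t
  have m1 : Measurable fun ω : Outcome E => (belief M cost solve t ω, ω.1) := by fun_prop
  have m2 : Measurable fun ω : Outcome E =>
      (belief M cost solve t ω, roundSample M cost solve t ω) :=
    hB.prodMk (measurable_roundSample M hC hS t)
  refine ⟨m1.aemeasurable, m2.aemeasurable, Measure.ext_of_lintegral _ fun F hF => ?_⟩
  rw [lintegral_map hF m1, lintegral_map hF m2, isCalibrated_belief M hP hM hC hS t F hF,
    lintegral_law_resample M (t + 1)
      (H := fun ω => F (belief M cost solve t ω, roundSample M cost solve t ω)) (hF.comp m2)]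
  refine lintegral_congr fun ω => ?_
  have e1 : ∀ y, F (belief M cost solve t (resample (t + 1) ω y),
      roundSample M cost solve t (resample (t + 1) ω y)) =
      F (belief M cost solve t ω, sample (belief M cost solve t ω) y.2) := by
    intro y
    rw [roundSample, belief_resample M (Nat.lt_succ_self t)]
    simp [resample]
  simp_rw [e1]
  have hs : Measurable (sample (belief M cost solve t ω)) :=
    measurable_sample.comp (measurable_const.prodMk measurable_id)
  rw [lintegral_prod (fun y : (E → ℝ) × (E → ℝ) =>
    F (belief M cost solve t ω, sample (belief M cost solve t ω) y.2))
    (Measurable.aemeasurable (by fun_prop))]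
  simp

end PosteriorSampling
-- First and second moments under the joint law.
section Moments

variable {E : Type*} [Fintype E] (M : Model E)

lemma integrable_sq_gaussianReal : Integrable (fun x : ℝ => x ^ 2) (gaussianReal 0 1) :=
  (memLp_id_gaussianReal (μ := 0) (v := 1) 2).integrable_sq

lemma integral_sq_gaussianReal : ∫ x, x ^ 2 ∂(gaussianReal 0 1) = 1 := by
  have h := variance_id_gaussianReal (μ := 0) (v := 1)
  rw [variance_eq_integral aemeasurable_id] at h
  simpa using h

lemma measurePreserving_mean (e : E) : MeasurePreserving (fun ω : Outcome E => ω.1 e) (law M)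
    (gaussianReal (M.priorMean e) (M.priorSd e ^ 2)) :=
  (measurePreserving_eval _ e).comp measurePreserving_fst

lemma measurePreserving_sampleNoise (n : ℕ) (e : E) :
    MeasurePreserving (fun ω : Outcome E => ω.2.2 n e) (law M) (gaussianReal 0 1) :=
  (measurePreserving_eval (fun _ : E => gaussianReal 0 1) e).comp
    ((measurePreserving_eval_infinitePi (fun _ : ℕ => stdNormal E) n).comp
      (measurePreserving_snd.comp measurePreserving_snd))

lemma integrable_mean (e : E) : Integrable (fun ω : Outcome E => ω.1 e) (law M) :=
  (measurePreserving_mean M e).integrable_comp_of_integrable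
    ((memLp_id_gaussianReal 1).integrable (by simp))

lemma integrable_sq_sampleNoise (n : ℕ) (e : E) :
    Integrable (fun ω : Outcome E => ω.2.2 n e ^ 2) (law M) :=
  (measurePreserving_sampleNoise M n e).integrable_comp_of_integrable integrable_sq_gaussianReal

lemma integral_sq_sampleNoise (n : ℕ) (e : E) :
    ∫ ω : Outcome E, ω.2.2 n e ^ 2 ∂(law M) = 1 := by
  have h := measurePreserving_sampleNoise M n e
  rw [← integral_sq_gaussianReal, ← h.map_eq,
    integral_map h.measurable.aemeasurable (by fun_prop)]

end Moments

/-! ### Harmonic decay of posterior variances. -/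

section Potential

variable {E : Type*} [Fintype E] [DecidableEq E] (M : Model E)
  {cost : (E → ℝ) → E → ℝ} {solve : (E → ℝ) → Finset E}

lemma one_le_inv_noise_sq {x : ℝ≥0} (h : 0 < x ∧ x ^ 2 ≤ 1) : (1 : ℝ) ≤ 1 / (x : ℝ) ^ 2 := by
  have h0 : (0 : ℝ) < x := by exact_mod_cast h.1
  have h1 : (x : ℝ) ^ 2 ≤ 1 := by exact_mod_cast h.2
  rw [le_div_iff₀ (by positivity)]
  linarith

omit [Fintype E] in
lemma inv_update_var_of_mem {a : Finset E} {r : E → ℝ} {p : Belief E} {e : E} (he : e ∈ a) :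
    ((update M a r p).var e : ℝ)⁻¹ = (p.var e : ℝ)⁻¹ + 1 / (M.noiseSd e : ℝ) ^ 2 := by
  simp [update, he]

/-- The posterior variances of an edge along the rounds in which it is traversed are dominated by
the harmonic sequence. -/
lemma exists_sum_var_le_harmonic (hM : ∀ e, 0 < M.noiseSd e ∧ M.noiseSd e ^ 2 ≤ 1)
    (ω : Outcome E) (e : E) (t : ℕ) :
    ∃ N ≤ t, (N : ℝ) + 1 ≤ ((belief M cost solve t ω).var e : ℝ)⁻¹ ∧
      ∑ i ∈ Finset.range t, (if e ∈ action M cost solve i ω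
        then ((belief M cost solve i ω).var e : ℝ) else 0) ≤ (harmonic N : ℝ) := by
  induction t with
  | zero =>
    -- `N` counts the plays after the initial one. The initial observation alone gives precision at
    -- least 1, whatever the prior; this makes the bound independent of the prior.
    refine ⟨0, le_rfl, ?_, by simp⟩
    rw [belief, inv_update_var_of_mem M (Finset.mem_univ e)]
    have := one_le_inv_noise_sq (hM e)
    have : (0 : ℝ) ≤ ((priorBelief M).var e : ℝ)⁻¹ := by positivity
    push_cast
    linarith
  | succ t ih =>
    obtain ⟨N, hN, h1, h2⟩ := ih
    rw [Finset.sum_range_succ]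
    by_cases he : e ∈ action M cost solve t ω
    · refine ⟨N + 1, by omega, ?_, ?_⟩
      · rw [belief, inv_update_var_of_mem (e := e) M (by exact he)]
        have := one_le_inv_noise_sq (hM e)
        push_cast
        linarith
      -- The variance before this play is at most 1/(N+1), exactly the next harmonic term.
      · rw [if_pos he, harmonic_succ]
        have h3 := inv_anti₀ (by positivity) h1
        rw [inv_inv] at h3
        push_cast
        linarith
    · refine ⟨N, by omega, ?_, by rw [if_neg he]; linarith⟩
      have : (belief M cost solve (t + 1) ω).var e = (belief M cost solve t ω).var e := by
        rw [belief]
        exact if_neg he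
      rwa [this]

lemma sum_var_le (hM : ∀ e, 0 < M.noiseSd e ∧ M.noiseSd e ^ 2 ≤ 1) (ω : Outcome E) (e : E)
    (T : ℕ) : ∑ i ∈ Finset.range T, (if e ∈ action M cost solve i ω
        then ((belief M cost solve i ω).var e : ℝ) else 0) ≤ 1 + Real.log T := by
  obtain ⟨N, hN, -, h⟩ := exists_sum_var_le_harmonic (cost := cost) (solve := solve) M hM ω e T
  refine (h.trans (harmonic_le_one_add_log N)).trans ?_
  -- Monotonicity of the logarithm needs N > 0; for N = 0 the convention log 0 = 0 applies.
  rcases Nat.eq_zero_or_pos N with rfl | h0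
  · simpa using Real.log_natCast_nonneg T
  · gcongr

lemma belief_var_le_one (hM : ∀ e, 0 < M.noiseSd e ∧ M.noiseSd e ^ 2 ≤ 1) (ω : Outcome E) (e : E)
    (t : ℕ) : ((belief M cost solve t ω).var e : ℝ) ≤ 1 := by
  obtain ⟨N, -, h, -⟩ := exists_sum_var_le_harmonic (cost := cost) (solve := solve) M hM ω e t
  have h3 := inv_anti₀ (by positivity) h
  rw [inv_inv] at h3
  exact h3.trans (inv_le_one_of_one_le₀ (by have := Nat.cast_nonneg (α := ℝ) N; linarith))

end Potential

/-! ### Regret of one round and of all rounds, for Lipschitz costs. -/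

section Regret

variable {E : Type*} [Fintype E] [DecidableEq E] (M : Model E)
  {cost : (E → ℝ) → E → ℝ} {solve : (E → ℝ) → Finset E} {arms : Finset (Finset E)}

omit [DecidableEq E] in
lemma measurable_cost (hL : ∀ θ θ' e, |cost θ e - cost θ' e| ≤ |θ e - θ' e|) :
    Measurable cost := by
  refine (continuous_pi fun e => ?_).measurable
  refine (LipschitzWith.of_dist_le_mul (K := 1) fun θ θ' => ?_).continuous
  rw [NNReal.coe_one, one_mul, Real.dist_eq]
  exact (hL θ θ' e).trans (dist_le_pi_dist θ θ' e)

omit [DecidableEq E] in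
lemma integrable_cost (hL : ∀ θ θ' e, |cost θ e - cost θ' e| ≤ |θ e - θ' e|) (e : E) :
    Integrable (fun ω : Outcome E => cost ω.1 e) (law M) := by
  have hm := measurable_cost hL
  refine ((integrable_mean M e).norm.add (integrable_const |cost 0 e|)).mono'
    (Measurable.aestronglyMeasurable (by fun_prop)) (ae_of_all _ fun ω => ?_)
  have h1 := hL ω.1 0 e
  have h2 := abs_sub_abs_le_abs_sub (cost ω.1 e) (cost 0 e)
  simp only [Pi.zero_apply, sub_zero, Real.norm_eq_abs, Pi.add_apply] at *
  linarith

omit [Fintype E] [DecidableEq E] in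
lemma sup'_expectedReward (h : arms.Nonempty) {θ : E → ℝ} (hmem : solve (cost θ) ∈ arms)
    (hle : ∀ a ∈ arms, ∑ e ∈ solve (cost θ), cost θ e ≤ ∑ e ∈ a, cost θ e) :
    arms.sup' h (expectedReward cost θ) = expectedReward cost θ (solve (cost θ)) :=
  le_antisymm (Finset.sup'_le _ _ fun a ha => neg_le_neg (hle a ha))
    (Finset.le_sup' (expectedReward cost θ) hmem)

lemma integrable_ite_mem {A : Outcome E → Finset E} {f : Outcome E → ℝ} {e : E}
    (hA : MeasurableSet {ω | e ∈ A ω}) (hf : Integrable f (law M)) :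
    Integrable (fun ω => if e ∈ A ω then f ω else 0) (law M) := by
  have : (fun ω => if e ∈ A ω then f ω else 0) = {ω | e ∈ A ω}.indicator f := by
    ext ω
    simp [Set.indicator]
  rw [this]
  exact hf.indicator hA

lemma integrable_expectedReward {A : Outcome E → Finset E}
    (hA : ∀ e, MeasurableSet {ω | e ∈ A ω})
    (hL : ∀ θ θ' e, |cost θ e - cost θ' e| ≤ |θ e - θ' e|) :
    Integrable (fun ω : Outcome E => expectedReward cost ω.1 (A ω)) (law M) := by
  have : (fun ω : Outcome E => expectedReward cost ω.1 (A ω)) =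
      fun ω => -∑ e, if e ∈ A ω then cost ω.1 e else 0 := by
    ext ω; simp [expectedReward]
  rw [this]
  exact (integrable_finsetSum _ fun e _ =>
    integrable_ite_mem M (hA e) (integrable_cost M hL e)).neg

/-- Squared deviation of a mean reward from the belief, in units of the belief variance. -/
noncomputable def standardizedSq (e : E) (q : Belief E × (E → ℝ)) : ℝ :=
  (q.2 e - q.1.mean e) ^ 2 / q.1.var e

omit [Fintype E] [DecidableEq E] in
lemma measurable_standardizedSq (e : E) : Measurable (standardizedSq e) := by
  have h1 : Measurable fun q : Belief E × (E → ℝ) => q.1.mean e :=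
    (measurable_mean e).comp measurable_fst
  have h2 : Measurable fun q : Belief E × (E → ℝ) => (q.1.var e : ℝ) :=
    measurable_coe_nnreal_real.comp ((measurable_var e).comp measurable_fst)
  unfold standardizedSq
  fun_prop

-- AM-GM: the difference of the two sides is a perfect square over a positive number. The free
-- parameter `l` plays the role that Cauchy-Schwarz would, and is tuned only at the end.
omit [Fintype E] [DecidableEq E] in
lemma abs_sub_mean_le {p : Belief E} {e : E} (hv : 0 < p.var e) (θ : E → ℝ) {l : ℝ} (hl : 0 < l) :
    |θ e - p.mean e| ≤ standardizedSq e (p, θ) / (2 * l) + l * p.var e / 2 := by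
  have hv' : (0 : ℝ) < p.var e := by exact_mod_cast hv
  have h : standardizedSq e (p, θ) / (2 * l) + l * p.var e / 2 - |θ e - p.mean e|
      = (|θ e - p.mean e| - l * p.var e) ^ 2 / (2 * l * p.var e) := by
    rw [standardizedSq, ← sq_abs]
    field_simp
    ring
  have : 0 ≤ (|θ e - p.mean e| - l * p.var e) ^ 2 / (2 * l * p.var e) := by positivity
  linarith

variable (hP : ∀ e, 0 < M.priorSd e) (hM : ∀ e, 0 < M.noiseSd e ∧ M.noiseSd e ^ 2 ≤ 1)
  (hS : ∀ a, MeasurableSet {w | solve w = a})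
  (hL : ∀ θ θ' e, |cost θ e - cost θ' e| ≤ |θ e - θ' e|)

include hS hL in
lemma measurableSet_mem_action (t : ℕ) (e : E) :
    MeasurableSet {ω | e ∈ action M cost solve t ω} :=
  (measurable_cost hL).comp (measurable_roundSample M (measurable_cost hL) hS t)
    (measurableSet_mem_solve hS e)

include hM hS hL in
lemma integrable_var_mem_action (t : ℕ) (e : E) :
    Integrable (fun ω => if e ∈ action M cost solve t ω
      then ((belief M cost solve t ω).var e : ℝ) else 0) (law M) := by
  refine integrable_ite_mem M (measurableSet_mem_action M hS hL t e) ?_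
  refine Integrable.of_bound (C := 1) (Measurable.aestronglyMeasurable ?_) (ae_of_all _ fun ω => ?_)
  · exact measurable_coe_nnreal_real.comp
      ((measurable_var e).comp (measurable_belief M (measurable_cost hL) hS t))
  · rw [Real.norm_eq_abs, abs_of_nonneg (NNReal.coe_nonneg _)]
    exact belief_var_le_one M hM ω e t

-- The sample deviates from the mean by the standard deviation times a standard normal. This gives
-- expectation 1, which identity of laws transfers to the true means.
include hP in
lemma standardizedSq_roundSample (t : ℕ) (ω : Outcome E) (e : E) :
    standardizedSq e (belief M cost solve t ω, roundSample M cost solve t ω) =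
      ω.2.2 (t + 1) e ^ 2 := by
  have hv : (0 : ℝ) < (belief M cost solve t ω).var e := by
    exact_mod_cast belief_var_pos M hP t ω e
  simp only [standardizedSq, roundSample, sample]
  rw [add_sub_cancel_left, mul_pow, Real.sq_sqrt hv.le]
  field_simp

include hP hM hS hL in
/-- The expected regret of one round is controlled by the variances of the traversed edges. -/
lemma integral_regret_round_le (h : arms.Nonempty) (hmem : ∀ θ, solve (cost θ) ∈ arms)
    (hle : ∀ θ, ∀ a ∈ arms, ∑ e ∈ solve (cost θ), cost θ e ≤ ∑ e ∈ a, cost θ e)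
    (t : ℕ) {l : ℝ} (hl : 0 < l) :
    Integrable (fun ω : Outcome E => arms.sup' h (expectedReward cost ω.1) -
      expectedReward cost ω.1 (action M cost solve t ω)) (law M) ∧
    ∫ ω : Outcome E, (arms.sup' h (expectedReward cost ω.1) -
      expectedReward cost ω.1 (action M cost solve t ω)) ∂(law M) ≤
      ∑ e, (1 / l + l * ∫ ω, (if e ∈ action M cost solve t ω
        then ((belief M cost solve t ω).var e : ℝ) else 0) ∂(law M)) := by
  have hC := measurable_cost hL
  have hid := identDistrib_roundSample M hP (fun e => (hM e).1) hC hS t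
  have hact := measurableSet_mem_action M hS hL t
  simp_rw [fun θ => sup'_expectedReward h (hmem θ) (hle θ)]
  have i1 : Integrable (fun ω : Outcome E => expectedReward cost ω.1 (solve (cost ω.1))) (law M) :=
    integrable_expectedReward M
      (fun e => (hC.comp measurable_fst) (measurableSet_mem_solve hS e)) hL
  have i2 := integrable_expectedReward M hact hL
  have mR : Measurable fun θ : E → ℝ => expectedReward cost θ (solve (cost θ)) := by
    have : (fun θ : E → ℝ => expectedReward cost θ (solve (cost θ))) =
        fun θ => -∑ e, if e ∈ solve (cost θ) then cost θ e else 0 := by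
      ext θ; simp [expectedReward]
    rw [this]
    refine (Finset.measurable_fun_sum _ fun e _ => Measurable.ite
      (hC (measurableSet_mem_solve hS e)) (by fun_prop) measurable_const).neg
  -- The played arm is the solver's answer at the sampled means, so its value there has the law of
  -- the optimal value.
  have hidR : IdentDistrib (fun ω : Outcome E => expectedReward cost ω.1 (solve (cost ω.1)))
      (fun ω => expectedReward cost (roundSample M cost solve t ω) (action M cost solve t ω))
      (law M) (law M) := hid.comp (mR.comp measurable_snd)
  have i3 := hidR.integrable_iff.1 i1
  refine ⟨i1.sub i2, ?_⟩
  rw [integral_sub i1 i2, hidR.integral_eq, ← integral_sub i3 i2]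
  have hidQ := fun e => hid.comp (measurable_standardizedSq e)
  have e4 : ∀ e, (standardizedSq e ∘ fun ω : Outcome E =>
      (belief M cost solve t ω, roundSample M cost solve t ω)) = fun ω => ω.2.2 (t + 1) e ^ 2 :=
    fun e => funext fun ω => standardizedSq_roundSample M hP t ω e
  have i4 : ∀ e, Integrable (fun ω : Outcome E => standardizedSq e
      (belief M cost solve t ω, roundSample M cost solve t ω)) (law M) := fun e => by
    have := integrable_sq_sampleNoise M (t + 1) e
    rwa [← e4] at this
  have i5 : ∀ e, Integrable (fun ω : Outcome E => standardizedSq e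
      (belief M cost solve t ω, ω.1)) (law M) := fun e => (hidQ e).integrable_iff.2 (i4 e)
  have v4 : ∀ e, ∫ ω : Outcome E, standardizedSq e
      (belief M cost solve t ω, roundSample M cost solve t ω) ∂(law M) = 1 := fun e => by
    have := integral_sq_sampleNoise M (t + 1) e
    rwa [← e4] at this
  have v5 : ∀ e, ∫ ω : Outcome E, standardizedSq e
      (belief M cost solve t ω, ω.1) ∂(law M) = 1 := fun e => (hidQ e).integral_eq.trans (v4 e)
  have i6 := integrable_var_mem_action M hM hS hL t
  have i7 : ∀ e, Integrable (fun ω : Outcome E =>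
      (standardizedSq e (belief M cost solve t ω, ω.1) / (2 * l) +
      standardizedSq e (belief M cost solve t ω, roundSample M cost solve t ω) / (2 * l)) +
      l * (if e ∈ action M cost solve t ω
        then ((belief M cost solve t ω).var e : ℝ) else 0)) (law M) := fun e =>
    (((i5 e).div_const _).add ((i4 e).div_const _)).add ((i6 e).const_mul l)
  calc _ ≤ ∫ ω : Outcome E, ∑ e,
      ((standardizedSq e (belief M cost solve t ω, ω.1) / (2 * l) +
      standardizedSq e (belief M cost solve t ω, roundSample M cost solve t ω) / (2 * l)) +
      l * (if e ∈ action M cost solve t ω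
        then ((belief M cost solve t ω).var e : ℝ) else 0)) ∂(law M) := by
        refine integral_mono (i3.sub i2) (integrable_finsetSum _ fun e _ => i7 e) fun ω => ?_
        have hq : ∀ e θ, 0 ≤ standardizedSq e (belief M cost solve t ω, θ) := fun e θ => by
          unfold standardizedSq; positivity
        -- With the cost vector frozen, both terms become sums over the same arm, and the argument
        -- `ω.1` is a dummy.
        have : ∀ f : E → ℝ, expectedReward (fun _ => f) ω.1 (action M cost solve t ω) =
          -∑ e, if e ∈ action M cost solve t ω then f e else 0 := by
          intro f; simp [expectedReward]
        change expectedReward (fun _ => cost (roundSample M cost solve t ω)) ω.1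
          (action M cost solve t ω) - expectedReward (fun _ => cost ω.1) ω.1
          (action M cost solve t ω) ≤ _
        rw [this, this, neg_sub_neg, ← Finset.sum_sub_distrib]
        refine Finset.sum_le_sum fun e _ => ?_
        have hv := belief_var_pos (cost := cost) (solve := solve) M hP t ω e
        split_ifs with he
        · have h1 := abs_sub_mean_le hv ω.1 hl
          have h2 := abs_sub_mean_le hv (roundSample M cost solve t ω) hl
          have h3 := (le_abs_self _).trans (hL ω.1 (roundSample M cost solve t ω) e)
          have h4 := abs_sub_le (ω.1 e) ((belief M cost solve t ω).mean e)
            (roundSample M cost solve t ω e)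
          rw [abs_sub_comm ((belief M cost solve t ω).mean e)] at h4
          linarith
        -- Squared deviations are kept for untraversed edges too, so that their expectations do not
        -- involve the random arm; the price is a sum over all edges.
        · have h1 := div_nonneg (hq e ω.1) (by positivity : 0 ≤ 2 * l)
          have h2 := div_nonneg (hq e (roundSample M cost solve t ω)) (by positivity : 0 ≤ 2 * l)
          linarith
    _ = _ := by
        rw [integral_finsetSum _ fun e _ => i7 e]
        refine Finset.sum_congr rfl fun e _ => ?_
        rw [integral_add (by exact ((i5 e).div_const _).add ((i4 e).div_const _))
          ((i6 e).const_mul l), integral_add ((i5 e).div_const _) ((i4 e).div_const _), integral_div, integral_div,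
          integral_const_mul, v4, v5]
        congr 1
        field_simp
        norm_num

include hP hM hS hL in
/-- Bayesian regret bound of Thompson Sampling for costs that are `1`-Lipschitz in the mean reward
of their edge. -/
theorem bayesRegret_le (h : arms.Nonempty) (hmem : ∀ θ, solve (cost θ) ∈ arms)
    (hle : ∀ θ, ∀ a ∈ arms, ∑ e ∈ solve (cost θ), cost θ e ≤ ∑ e ∈ a, cost θ e) (T : ℕ) :
    Integrable (regret M arms h cost solve T) (law M) ∧
      bayesRegret M arms h cost solve T ≤
        2 * (Fintype.card E * Real.sqrt T) * (1 + Real.log T) ^ 1 := by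
  have hround := fun t {l : ℝ} (hl : 0 < l) =>
    integral_regret_round_le M hP hM hS hL h hmem hle t hl
  refine ⟨integrable_finsetSum _ fun t _ => (hround t one_pos).1, ?_⟩
  have hlog := Real.log_natCast_nonneg T
  rcases Nat.eq_zero_or_pos T with rfl | hT
  · simp [bayesRegret, regret]
  have hs : 0 < Real.sqrt T := Real.sqrt_pos.2 (by exact_mod_cast hT)
  have i6 := integrable_var_mem_action M hM hS hL
  unfold bayesRegret regret
  rw [integral_finsetSum _ fun t _ => (hround t hs).1]
  -- The choice l = √T balances T/l against l (1 + log T) for each edge, up to the logarithm.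
  calc _ ≤ ∑ t ∈ Finset.range T, ∑ e, (1 / Real.sqrt T + Real.sqrt T *
        ∫ ω, (if e ∈ action M cost solve t ω
          then ((belief M cost solve t ω).var e : ℝ) else 0) ∂(law M)) :=
        Finset.sum_le_sum fun t _ => (hround t hs).2
    _ = ∑ e : E, (Real.sqrt T + Real.sqrt T * ∫ ω, ∑ t ∈ Finset.range T,
          (if e ∈ action M cost solve t ω
            then ((belief M cost solve t ω).var e : ℝ) else 0) ∂(law M)) := by
        rw [Finset.sum_comm]
        refine Finset.sum_congr rfl fun e _ => ?_
        rw [integral_finsetSum _ fun t _ => i6 t e, Finset.sum_add_distrib, Finset.mul_sum,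
          Finset.sum_const, Finset.card_range, nsmul_eq_mul, mul_one_div, Real.div_sqrt]
    _ ≤ ∑ _e : E, (Real.sqrt T + Real.sqrt T * (1 + Real.log T)) := by
        refine Finset.sum_le_sum fun e _ => ?_
        gcongr
        refine (integral_mono (integrable_finsetSum _ fun t _ => i6 t e)
          (integrable_const (1 + Real.log T)) fun ω => sum_var_le M hM ω e T).trans ?_
        simp
    _ ≤ _ := by
        rw [Finset.sum_const, Finset.card_univ, nsmul_eq_mul, pow_one]
        have : (0 : ℝ) ≤ Fintype.card E * Real.sqrt T * Real.log T := by positivity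
        nlinarith

end Regret

/-! ### Lipschitz bound for the rectified Gaussian cost. -/

section Costs

variable {E : Type*} (M : Model E)

/-- Centring the Gaussian moves the dependence on the mean from the measure to the integrand, where
the Lipschitz bound is pointwise. -/
lemma rectifiedCost_eq (θ : E → ℝ) (e : E) : rectifiedCost M θ e =
    ∫ x, max 0 (x - θ e) ∂(gaussianReal 0 (M.noiseSd e ^ 2)) := by
  have h := gaussianReal_map_sub_const (μ := 0) (v := M.noiseSd e ^ 2) (θ e)
  rw [zero_sub] at h
  rw [rectifiedCost, rectifiedGaussian, ← h,
    integral_map (by fun_prop) (by fun_prop), integral_map (by fun_prop) (by fun_prop)]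

lemma rectifiedCost_nonneg (θ : E → ℝ) (e : E) : 0 ≤ rectifiedCost M θ e := by
  rw [rectifiedCost_eq]
  exact integral_nonneg fun x => le_max_left _ _

lemma abs_rectifiedCost_sub_le (θ θ' : E → ℝ) (e : E) :
    |rectifiedCost M θ e - rectifiedCost M θ' e| ≤ |θ e - θ' e| := by
  have hi : ∀ c : ℝ, Integrable (fun x => max 0 (x - c)) (gaussianReal 0 (M.noiseSd e ^ 2)) := by
    intro c
    have h : Integrable (fun x : ℝ => x - c) (gaussianReal 0 (M.noiseSd e ^ 2)) :=
      ((memLp_id_gaussianReal 1).integrable (by simp)).sub (integrable_const c)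
    simpa only [max_comm] using h.pos_part
  rw [rectifiedCost_eq, rectifiedCost_eq, ← integral_sub (hi _) (hi _)]
  have hb := norm_integral_le_of_norm_le_const (μ := gaussianReal 0 (M.noiseSd e ^ 2))
    (f := fun x => max 0 (x - θ e) - max 0 (x - θ' e)) (C := |θ e - θ' e|)
    (ae_of_all _ fun x => ?_)
  · rwa [probReal_univ, mul_one] at hb
  refine (abs_max_sub_max_le_max _ _ _ _).trans ?_
  rw [sub_self, abs_zero, sub_sub_sub_cancel_left, abs_sub_comm, max_eq_right (abs_nonneg _)]

end Costs

end EnergyBandit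

theorem mainTheorem4 :
    ∃ (C : ℝ) (k : ℕ), ∀ (V : Type*) [Fintype V] [DecidableEq V] (G : RoadNetwork V) (s d : V)
      (hP : (G.superArms s d).Nonempty) (M : EnergyBandit.Model G.Edge)
      (_ : ∀ e, 0 < M.priorSd e) (_ : ∀ e, 0 < M.noiseSd e ∧ M.noiseSd e ^ 2 ≤ 1)
      (solve : (G.Edge → ℝ) → Finset G.Edge) (T : ℕ),
      -- rectified Gaussian model
      (G.IsShortestPathSolver s d {w | ∀ e, 0 ≤ w e} solve →
        Integrable (EnergyBandit.regret M (G.superArms s d) hP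
          (EnergyBandit.rectifiedCost M) solve T) (EnergyBandit.law M) ∧
        EnergyBandit.bayesRegret M (G.superArms s d) hP (EnergyBandit.rectifiedCost M) solve T
          ≤ C * (G.edges.card * Real.sqrt T) * (1 + Real.log T) ^ k) ∧
      -- non-rectified Gaussian model
      (G.IsShortestPathSolver s d Set.univ solve →
        Integrable (EnergyBandit.regret M (G.superArms s d) hP
          EnergyBandit.gaussianCost solve T) (EnergyBandit.law M) ∧
        EnergyBandit.bayesRegret M (G.superArms s d) hP EnergyBandit.gaussianCost solve T
          ≤ C * (G.edges.card * Real.sqrt T) * (1 + Real.log T) ^ k) := by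
  refine ⟨2, 1, fun V _ _ G s d hP M hprior hnoise solve T => ⟨fun h => ?_, fun h => ?_⟩⟩
  -- Rectified costs are nonnegative, so correctness of the solver on nonnegative weights suffices
  -- here.
  · have := EnergyBandit.bayesRegret_le M hprior hnoise h.measurableSet_eq
      (EnergyBandit.abs_rectifiedCost_sub_le M) hP
      (fun θ => h.mem _ (EnergyBandit.rectifiedCost_nonneg M θ))
      (fun θ => h.le _ (EnergyBandit.rectifiedCost_nonneg M θ)) T
    rwa [Fintype.card_coe] at this
  · have := EnergyBandit.bayesRegret_le (cost := EnergyBandit.gaussianCost) M hprior hnoise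
      h.measurableSet_eq
      (fun θ θ' e => by rw [EnergyBandit.gaussianCost, EnergyBandit.gaussianCost, neg_sub_neg,
        abs_sub_comm]) hP
      (fun θ => h.mem _ (Set.mem_univ _)) (fun θ => h.le _ (Set.mem_univ _)) T
    rwa [Fintype.card_coe] at this
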